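/- For mass functions $p,q$ on $[k]=\{1,\dots,k\}$ let $d_{\mathrm H}(p,q)=\frac1{\sqrt2}\big(\sum_{i=1}^k(\sqrt{p(i)}-\sqrt{q(i)})^2\big)^{1/2}$ be the Hellinger distance. Let $\Phi(d_{\mathrm H},k,\varepsilon,\delta)$ be the sample complexity of learning distributions over $[k]$: the least $n$ for which there is a (possibly randomized) learner that, given $n$ independent samples from an arbitrary unknown probability distribution $p$ on $[k]$, outputs a probability distribution $q$ on $[k]$ such that $d_{\mathrm H}(p,q)\le\varepsilon$ with probability at least $1-\delta$. Then $\Phi(d_{\mathrm H},k,\varepsilon,\delta)=\Theta\big(\frac{k+\log(1/\delta)}{\varepsilon^2}\big)$, and the upper bound is attained by the empirical distribution. Precisely, there are absolute constants $c,C,\varepsilon_0,\delta_0>0$ such that: 1. (Lower bound) for all integers $k\ge2$, all $0<\varepsilon\le\varepsilon_0$ and all $0<\delta\le\delta_0$, $$\Phi(d_{\mathrm H},k,\varepsilon,\delta)\ \ge\ c\,\frac{k+\log(1/\delta)}{\varepsilon^2};$$ 2. (Upper bound) for all integers $k\ge1$, all $\varepsilon>0$ and all $\delta\in(0,1]$,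 $$\Phi(d_{\mathrm H},k,\varepsilon,\delta)\ \le\ C\,\frac{k+\log(1/\delta)}{\varepsilon^2};$$ 3. (Empirical distribution) for all integers $k\ge1$, all $\varepsilon>0$, all $\delta\in(0,1]$, every integer $n\ge C\,\frac{k+\log(1/\delta)}{\varepsilon^2}$ and every probability distribution $p$ on $[k]$, the empirical distribution $\widehat p(i)=\frac1n\#\{j\le n: s_j=i\}$ of $n$ independent samples $s_1,\dots,s_n$ from $p$ satisfies $d_{\mathrm H}(p,\widehat p)\le\varepsilon$ with probability at least $1-\delta$. -/

import Mathlib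

open MeasureTheory ProbabilityTheory

noncomputable section

/-- Probability distributions on a domain of size `k`, given by their mass functions. -/
abbrev FinDistrib (k : ℕ) : Type := stdSimplex ℝ (Fin k)

/-- The Hellinger distance `(1/√2) ‖√p - √q‖₂` of two mass functions. -/
def hellinger {k : ℕ} (p q : Fin k → ℝ) : ℝ :=
  1 / Real.sqrt 2 * Real.sqrt (∑ i, (Real.sqrt (p i) - Real.sqrt (q i)) ^ 2)

/-- The probability measure on the domain with mass function `p`. -/
def FinDistrib.toMeasure {k : ℕ} (p : FinDistrib k) : Measure (Fin k) :=
  ∑ i, ENNReal.ofReal (p.1 i) • Measure.dirac i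

/-- The joint law of `n` independent samples from `p`. -/
def sampleLaw {k : ℕ} (n : ℕ) (p : FinDistrib k) : Measure (Fin n → Fin k) :=
  Measure.pi fun _ => p.toMeasure

/-- `n` samples suffice for learning to accuracy `ε` in the distance `d` with failure probability
`δ`: some learner, deterministic or randomized (a Markov kernel from samples to distributions),
outputs, for every unknown `p`, a distribution `q` with `d p q ≤ ε` with probability at least
`1 - δ`, over the samples and over the internal randomness of the learner. -/
def Learnable (k : ℕ) (d : (Fin k → ℝ) → (Fin k → ℝ) → ℝ) (ε δ : ℝ) (n : ℕ) : Prop :=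
  ∃ κ : Kernel (Fin n → Fin k) (FinDistrib k), IsMarkovKernel κ ∧
    ∀ p : FinDistrib k,
      ENNReal.ofReal (1 - δ) ≤ ((sampleLaw n p).bind κ) {q : FinDistrib k | d p.1 q.1 ≤ ε}

/-- The sample complexity: the least number of samples that suffices (`⊤` if none does). -/
def sampleComplexity (k : ℕ) (d : (Fin k → ℝ) → (Fin k → ℝ) → ℝ) (ε δ : ℝ) : ℕ∞ :=
  ⨅ n ∈ {n : ℕ | Learnable k d ε δ n}, (n : ℕ∞)

/-- The empirical mass function `i ↦ #{j | s j = i} / n` of the samples `s`. -/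
def empirical {k n : ℕ} (s : Fin n → Fin k) : Fin k → ℝ :=
  fun i => (∑ j, if s j = i then (1 : ℝ) else 0) / n

end

/-! Upper bound. Let H be the Hellinger distance from `p` to the empirical law. The core is the
moment bound E exp(n H²) ≤ 4^k (`sum_prod_mul_exp_hellinger_le`); Markov's inequality then bounds
the failure probability by 4^k exp(-n ε²). With counts N_i, n H² = ∑ (N_i - √(n p_i N_i)), so
t·exp(1 - t) ≤ 1 at t = √(n p_i / N_i) gives exp(n H²) ≤ √(L̂ / L), where L is the likelihood and L̂
= ∏ (N_i / n)^{N_i} its maximum. It remains to show that √(L L̂), summed over all samples, is at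
most 4^k. Exponential generating functions turn this sum into a coefficient of a product over cells,
and adding one cell is a binomial problem costing a factor 4 (`binomial_half_sum_antidiagonal_le`).
There the Chernoff bound replaces L̂ by L / T, with T the tail mass; the terms become (T_a -
T_{a+1}) / √T_a, which telescope.

Lower bound. Assouad's method on ⌊k/2⌋ pairs, each tilted one way or the other by g = 12 ε, gives n
ε² ≳ k; a single pair (Le Cam) gives n ε² ≳ log(1/δ). Both rest on `bhattacharyya_pow_le`, which
bounds the n-th power of the affinity of two hypotheses by the square roots of the error
probabilities of any randomized test. -/

/-! ### Half-order likelihood ratio sums of binomial laws -/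

/-- The right Chernoff tail of a binomial sum, weighted by the maximum likelihood. -/
theorem binomial_tail_mul_le {p q : ℝ} (hp : 0 ≤ p) (hq : 0 ≤ q) {a n : ℕ} (ha : a ≤ n)
    (h : ((n - a : ℕ) : ℝ) * p ≤ a * q) :
    (∑ j ∈ Finset.Ico a (n + 1), (n.choose j : ℝ) * (p ^ j * q ^ (n - j))) *
      ((a : ℝ) ^ a * ((n - a : ℕ) : ℝ) ^ (n - a)) ≤ p ^ a * q ^ (n - a) * (n : ℝ) ^ n := by
  have hn : ((n : ℝ)) ^ n = ∑ j ∈ Finset.range (n + 1),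
      (a : ℝ) ^ j * ((n - a : ℕ) : ℝ) ^ (n - j) * (n.choose j : ℝ) := by
    rw [← add_pow]; congr 1; rw [Nat.cast_sub ha]; ring
  rw [hn, Finset.sum_mul, Finset.mul_sum]
  refine (Finset.sum_le_sum (g := fun j => p ^ a * q ^ (n - a) *
    ((a : ℝ) ^ j * ((n - a : ℕ) : ℝ) ^ (n - j) * (n.choose j : ℝ))) ?_).trans ?_
  · intro j hj
    obtain ⟨h1, h2⟩ := Finset.mem_Ico.1 hj
    obtain ⟨d, rfl⟩ := Nat.exists_eq_add_of_le h1
    obtain ⟨e, rfl⟩ := Nat.exists_eq_add_of_le (Nat.lt_succ_iff.1 h2)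
    have e1 : a + d + e - (a + d) = e := by omega
    have e2 : a + d + e - a = d + e := by omega
    rw [e1, e2]
    rw [e2] at h
    -- With j = a + d, the two j-th terms share all factors except ((n - a) p)^d and (a q)^d.
    have := pow_le_pow_left₀ (by positivity) h d
    rw [mul_pow, mul_pow] at this
    have key : 0 ≤ ((a + d + e).choose (a + d) : ℝ) * (p ^ a * q ^ e * a ^ a * ((d + e : ℕ) : ℝ) ^ e) := by
      positivity
    have := mul_le_mul_of_nonneg_left this key
    simp only [pow_add] at this ⊢
    linarith
  · refine Finset.sum_le_sum_of_subset_of_nonneg (fun j hj => ?_) (fun j _ _ => by positivity)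
    simp only [Finset.mem_Ico, Finset.mem_range] at *; omega

/-- Factor x - y = (√x - √y)(√x + √y) and use √x + √y ≤ 2√x. This is the discrete form of ∫ dT / √T
= 2√T and makes the tail sums telescope. -/
theorem sub_div_sqrt_le {x y : ℝ} (hx : 0 ≤ x) (hy : 0 ≤ y) (hxy : y ≤ x) :
    (x - y) / √x ≤ 2 * (√x - √y) := by
  rcases hx.eq_or_lt with rfl | hx'
  · simp [le_antisymm hxy hy]
  rw [div_le_iff₀ (by positivity)]
  have h1 := Real.sqrt_le_sqrt hxy
  nlinarith [Real.sq_sqrt hx, Real.sq_sqrt hy, Real.sqrt_nonneg x, Real.sqrt_nonneg y,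
    sq_nonneg (√x - √y)]

/-- The half-order likelihood ratio sum of a binomial law over its right part. -/
theorem binomial_half_sum_le {p q : ℝ} (hp : 0 ≤ p) (hq : 0 ≤ q) (n : ℕ) :
    ∑ a ∈ (Finset.range (n + 1)).filter (fun a => ((n - a : ℕ) : ℝ) * p ≤ a * q),
      (n.choose a : ℝ) * (√(p * a) ^ a * √(q * (n - a : ℕ)) ^ (n - a)) ≤
      2 * √(n * (p + q)) ^ n := by
  set T : ℕ → ℝ := fun a => ∑ j ∈ Finset.Ico a (n + 1), (n.choose j : ℝ) * (p ^ j * q ^ (n - j))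
    with hT
  have hT0 : ∀ a, 0 ≤ T a := fun a => Finset.sum_nonneg fun j _ => by positivity
  have hTs : ∀ a ≤ n, T a - T (a + 1) = (n.choose a : ℝ) * (p ^ a * q ^ (n - a)) := by
    intro a ha
    simp only [hT]
    rw [Finset.sum_eq_sum_Ico_succ_bot (by omega)]; ring
  have hTstep : ∀ a ≤ n, T (a + 1) ≤ T a := fun a ha => by
    have h1 := hTs a ha
    have h2 : 0 ≤ (n.choose a : ℝ) * (p ^ a * q ^ (n - a)) := by positivity
    linarith
  have hTz : T 0 = (p + q) ^ n := by
    simp only [hT, add_pow, ← Finset.range_eq_Ico]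
    exact Finset.sum_congr rfl fun j _ => by ring
  have hpow : ∀ (x : ℝ) (m : ℕ), 0 ≤ x → √x ^ m = √(x ^ m) := fun x m hx => by
    refine ((Real.sqrt_eq_iff_mul_self_eq (by positivity) (by positivity)).2 ?_).symm
    rw [← mul_pow, Real.mul_self_sqrt hx]
  have hterm : ∀ a ∈ (Finset.range (n + 1)).filter (fun a => ((n - a : ℕ) : ℝ) * p ≤ a * q),
      (n.choose a : ℝ) * (√(p * a) ^ a * √(q * (n - a : ℕ)) ^ (n - a)) ≤
        2 * √((n : ℝ) ^ n) * (√(T a) - √(T (a + 1))) := by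
    intro a ha
    obtain ⟨h1, h2⟩ := Finset.mem_filter.1 ha
    have han : a ≤ n := Nat.lt_succ_iff.1 (Finset.mem_range.1 h1)
    have hb := binomial_tail_mul_le hp hq han h2
    change T a * _ ≤ _ at hb
    have hle := sub_div_sqrt_le (hT0 a) (hT0 (a + 1)) (hTstep a han)
    rw [hTs a han] at hle
    suffices hs : (n.choose a : ℝ) * (√(p * a) ^ a * √(q * (n - a : ℕ)) ^ (n - a)) ≤
        √((n : ℝ) ^ n) * ((n.choose a : ℝ) * (p ^ a * q ^ (n - a)) / √(T a)) by
      have := mul_le_mul_of_nonneg_left hle (Real.sqrt_nonneg ((n : ℝ) ^ n))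
      linarith
    rw [hpow _ _ (by positivity), hpow _ _ (by positivity), ← Real.sqrt_mul (by positivity)]
    -- If the tail vanishes, division by zero makes the right side 0, so p^a q^(n-a) = 0 is used to
    -- kill the left side as well.
    rcases (hT0 a).eq_or_lt with h0 | h0
    · have h3 := hTs a han
      have h4 : 0 ≤ (n.choose a : ℝ) * (p ^ a * q ^ (n - a)) := by positivity
      have h5 : (n.choose a : ℝ) * (p ^ a * q ^ (n - a)) = 0 :=
        le_antisymm (by linarith [hT0 (a + 1)]) h4
      have hc : (n.choose a : ℝ) ≠ 0 := by exact_mod_cast (Nat.choose_pos han).ne'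
      have h6 := (mul_eq_zero.1 h5).resolve_left hc
      have : (p * a) ^ a * (q * (n - a : ℕ)) ^ (n - a) = 0 := by
        rw [mul_pow, mul_pow]; linear_combination (a : ℝ) ^ a * ((n - a : ℕ) : ℝ) ^ (n - a) * h6
      rw [this, h5]; simp
    · rw [← mul_div_assoc, le_div_iff₀ (by positivity), mul_assoc, ← Real.sqrt_mul (by positivity)]
      have h3 : √((p * a) ^ a * (q * (n - a : ℕ)) ^ (n - a) * T a) ≤
          √((n : ℝ) ^ n) * (p ^ a * q ^ (n - a)) := by
        rw [Real.sqrt_le_left (by positivity), mul_pow √((n : ℝ) ^ n), Real.sq_sqrt (by positivity)]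
        have := mul_le_mul_of_nonneg_left hb (by positivity : 0 ≤ p ^ a * q ^ (n - a))
        rw [mul_pow, mul_pow]
        linarith
      have := mul_le_mul_of_nonneg_left h3 (by positivity : 0 ≤ (n.choose a : ℝ))
      linarith
  refine (Finset.sum_le_sum hterm).trans ?_
  rw [← Finset.mul_sum]
  have h1 : ∑ a ∈ (Finset.range (n + 1)).filter (fun a => ((n - a : ℕ) : ℝ) * p ≤ a * q),
      (√(T a) - √(T (a + 1))) ≤ ∑ a ∈ Finset.range (n + 1), (√(T a) - √(T (a + 1))) := by
    refine Finset.sum_le_sum_of_subset_of_nonneg (Finset.filter_subset _ _) fun a ha _ => ?_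
    exact sub_nonneg.2 (Real.sqrt_le_sqrt (hTstep a (Nat.lt_succ_iff.1 (Finset.mem_range.1 ha))))
  rw [Finset.sum_range_sub'] at h1
  have h2 : √(n * (p + q)) ^ n = √((n : ℝ) ^ n) * √(T 0) := by
    rw [hpow _ _ (by positivity), hTz, mul_pow, Real.sqrt_mul (by positivity)]
  rw [h2, mul_assoc]
  have h3 := Real.sqrt_nonneg (T (n + 1))
  gcongr
  linarith

/-- The binomial case of the exponential moment bound for the empirical likelihood ratio. -/
theorem binomial_half_sum_antidiagonal_le {p q : ℝ} (hp : 0 ≤ p) (hq : 0 ≤ q) (n : ℕ) :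
    ∑ x ∈ Finset.HasAntidiagonal.antidiagonal n,
      (n.choose x.1 : ℝ) * (√(p * x.1) ^ x.1 * √(q * x.2) ^ x.2) ≤ 4 * √(n * (p + q)) ^ n := by
  have hr := binomial_half_sum_le hp hq n
  have hl := binomial_half_sum_le hq hp n
  rw [Finset.Nat.sum_antidiagonal_eq_sum_range_succ
    (fun a b => (n.choose a : ℝ) * (√(p * a) ^ a * √(q * b) ^ b))]
  rw [← Finset.sum_filter_add_sum_filter_not _ (fun a => ((n - a : ℕ) : ℝ) * p ≤ a * q)]
  -- The reflection a ↦ n - a exchanges p and q and carries the left part into the right part of the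
  -- reversed law.
  have : ∑ a ∈ (Finset.range (n + 1)).filter (fun a => ¬ ((n - a : ℕ) : ℝ) * p ≤ a * q),
      (n.choose a : ℝ) * (√(p * a) ^ a * √(q * (n - a : ℕ)) ^ (n - a)) ≤
    ∑ a ∈ (Finset.range (n + 1)).filter (fun a => ((n - a : ℕ) : ℝ) * q ≤ a * p),
      (n.choose a : ℝ) * (√(q * a) ^ a * √(p * (n - a : ℕ)) ^ (n - a)) := by
    rw [Finset.sum_filter, Finset.sum_filter, ← Finset.sum_range_reflect]
    refine Finset.sum_le_sum fun a ha => ?_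
    have han : a ≤ n := Nat.lt_succ_iff.1 (Finset.mem_range.1 ha)
    have e1 : n + 1 - 1 - a = n - a := by omega
    have e2 : n - (n - a) = a := by omega
    rw [e1, e2, Nat.choose_symm han]
    split_ifs with h1 h2 h2
    · positivity
    · exact le_rfl
    · exact le_of_eq (by ring)
    · exact absurd (not_le.1 h1).le h2
  rw [add_comm q p] at hl
  linarith

/-! ### Counts and the multinomial likelihood ratio sum -/

/-- The number of samples that take the value `i`. -/
def sampleCount {k n : ℕ} (s : Fin n → Fin k) (i : Fin k) : ℕ :=
  (Finset.univ.filter fun j => s j = i).card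

theorem prod_comp_eq_prod_pow_sampleCount {M : Type*} [CommMonoid M] {k n : ℕ}
    (s : Fin n → Fin k) (f : Fin k → M) : ∏ j, f (s j) = ∏ i, f i ^ sampleCount s i := by
  rw [← Finset.prod_fiberwise_of_maps_to (g := s) (t := Finset.univ) (by simp)]
  refine Finset.prod_congr rfl fun i _ => ?_
  rw [sampleCount, ← Finset.prod_const]
  exact Finset.prod_congr rfl fun j hj => by rw [(Finset.mem_filter.1 hj).2]

theorem sum_sampleCount {k n : ℕ} (s : Fin n → Fin k) : ∑ i, sampleCount s i = n := by
  have := Finset.card_eq_sum_card_fiberwise (f := s) (s := Finset.univ) (t := Finset.univ)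
    (by simp)
  simpa [sampleCount] using this.symm

/-- Sums over samples of functions of the counts that factor are coefficients of a product of
exponential generating functions. -/
theorem sum_prod_sampleCount {k : ℕ} (w : Fin k → ℕ → ℝ) (n : ℕ) :
    ∑ s : Fin n → Fin k, ∏ i, w i (sampleCount s i) =
      n.factorial * PowerSeries.coeff n
        (∏ i, PowerSeries.mk fun N => w i N / (N.factorial : ℝ)) := by
  classical
  -- This linear functional replaces each monomial by its weight. Applied to (∑ X_i)^n, it gives the
  -- sum over samples when the power is expanded over words, and the coefficient when it is expanded
  -- by the multinomial theorem.
  set L : MvPolynomial (Fin k) ℝ →ₗ[ℝ] ℝ :=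
    (MvPolynomial.basisMonomials (Fin k) ℝ).constr ℝ (fun d => ∏ i, w i (d i)) with hL
  have hL1 : ∀ N : Fin k → ℕ, L (∏ i, MvPolynomial.X i ^ N i) = ∏ i, w i (N i) := by
    intro N
    have h : (∏ i, (MvPolynomial.X i : MvPolynomial (Fin k) ℝ) ^ N i) =
        MvPolynomial.basisMonomials (Fin k) ℝ (Finsupp.equivFunOnFinite.symm N) := by
      rw [MvPolynomial.coe_basisMonomials]
      dsimp only
      rw [MvPolynomial.monomial_eq, Finsupp.prod_fintype]
      · simp
      · simp
    rw [h, hL, Module.Basis.constr_basis]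
    simp
  have h1 : ∑ s : Fin n → Fin k, ∏ i, w i (sampleCount s i) =
      L ((∑ i, MvPolynomial.X i) ^ n) := by
    rw [Fintype.sum_pow, map_sum]
    refine Finset.sum_congr rfl fun s _ => ?_
    rw [prod_comp_eq_prod_pow_sampleCount, hL1]
  rw [h1, Finset.sum_pow_eq_sum_piAntidiag, map_sum, PowerSeries.coeff_prod, Finset.mul_sum]
  refine (Finset.sum_equiv Finsupp.equivFunOnFinite ?_ ?_).symm
  · intro d
    simp [Finset.mem_finsuppAntidiag, Finset.mem_piAntidiag]
  · intro d hd
    obtain ⟨hd1, -⟩ := Finset.mem_finsuppAntidiag.1 hd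
    simp only [PowerSeries.coeff_mk]
    rw [← nsmul_eq_mul (Nat.multinomial _ _), map_nsmul, hL1, nsmul_eq_mul, Finset.prod_div_distrib, ← mul_div_assoc,
      div_eq_iff (Finset.prod_ne_zero_iff.2 fun i _ => by positivity)]
    have h := Nat.multinomial_spec Finset.univ (Finsupp.equivFunOnFinite d)
    simp only [Finsupp.equivFunOnFinite_apply] at h ⊢
    rw [hd1] at h
    rw [← h]
    push_cast
    ring

/-- The half-order likelihood ratio sum of a multinomial law, in generating function form. -/
theorem coeff_prod_half_le {k : ℕ} {p : Fin k → ℝ} (hp : ∀ i, 0 ≤ p i) (S : Finset (Fin k)) :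
    ∀ n : ℕ, 0 ≤ PowerSeries.coeff n
        (∏ i ∈ S, PowerSeries.mk fun N => √(p i * N) ^ N / (N.factorial : ℝ)) ∧
      PowerSeries.coeff n
        (∏ i ∈ S, PowerSeries.mk fun N => √(p i * N) ^ N / (N.factorial : ℝ)) ≤
      4 ^ S.card * √(n * ∑ i ∈ S, p i) ^ n / n.factorial := by
  classical
  induction S using Finset.induction_on with
  | empty =>
    intro n
    rcases n with _ | n
    · simp
    · simp [PowerSeries.coeff_one]
  | insert i S hi ih =>
    intro n
    rw [Finset.prod_insert hi, PowerSeries.coeff_mul]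
    simp only [PowerSeries.coeff_mk]
    refine ⟨Finset.sum_nonneg fun x _ => mul_nonneg (by positivity) (ih x.2).1, ?_⟩
    rw [Finset.card_insert_of_notMem hi, Finset.sum_insert hi]
    have hS : 0 ≤ ∑ i ∈ S, p i := Finset.sum_nonneg fun i _ => hp i
    set P := ∑ i ∈ S, p i
    -- By induction the cells of `S` act as one cell of mass `P`, leaving a two-cell problem for `i`
    -- against `S`.
    calc _ ≤ ∑ x ∈ Finset.HasAntidiagonal.antidiagonal n, √(p i * x.1) ^ x.1 / x.1.factorial *
          (4 ^ S.card * √(x.2 * P) ^ x.2 / x.2.factorial) :=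
          Finset.sum_le_sum fun x _ => mul_le_mul_of_nonneg_left (ih x.2).2 (by positivity)
      _ = 4 ^ S.card / n.factorial * ∑ x ∈ Finset.HasAntidiagonal.antidiagonal n,
          (n.choose x.1 : ℝ) * (√(p i * x.1) ^ x.1 * √(P * x.2) ^ x.2) := by
          rw [Finset.mul_sum]
          refine Finset.sum_congr rfl fun x hx => ?_
          have hx := Finset.HasAntidiagonal.mem_antidiagonal.1 hx
          have h := Nat.add_choose_mul_factorial_mul_factorial x.2 x.1
          rw [add_comm, hx] at h
          have h' : (n.choose x.1 : ℝ) * x.1.factorial * x.2.factorial = n.factorial := by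
            rw [mul_right_comm]; exact_mod_cast h
          rw [mul_comm P, ← h']
          have h0 : (n.choose x.1 : ℝ) ≠ 0 := by
            have := Nat.choose_pos (n := n) (k := x.1) (by omega)
            positivity
          field_simp
      _ ≤ 4 ^ S.card / n.factorial * (4 * √(n * (p i + P)) ^ n) :=
          mul_le_mul_of_nonneg_left (binomial_half_sum_antidiagonal_le (hp i) hS n)
            (by positivity)
      _ = _ := by rw [pow_succ]; ring

theorem sum_prod_half_le {k : ℕ} {p : Fin k → ℝ} (hp : ∀ i, 0 ≤ p i) (hp1 : ∑ i, p i = 1)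
    (n : ℕ) :
    ∑ s : Fin n → Fin k, ∏ i, √(p i * sampleCount s i) ^ sampleCount s i ≤
      4 ^ k * √(n : ℝ) ^ n := by
  rw [sum_prod_sampleCount (fun i N => √(p i * N) ^ N)]
  have h := (coeff_prod_half_le hp Finset.univ n).2
  rw [hp1, mul_one, Finset.card_univ, Fintype.card_fin, le_div_iff₀ (by positivity)] at h
  linarith

/-! ### Exponential moment of the squared Hellinger distance -/

theorem empirical_eq {k n : ℕ} (s : Fin n → Fin k) (i : Fin k) :
    empirical s i = sampleCount s i / n := by
  simp [empirical, sampleCount, Finset.sum_boole]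

theorem sum_empirical {k n : ℕ} (hn : n ≠ 0) (s : Fin n → Fin k) : ∑ i, empirical s i = 1 := by
  simp only [empirical_eq]
  rw [← Finset.sum_div, ← Nat.cast_sum, sum_sampleCount, div_self (by exact_mod_cast hn)]

theorem empirical_nonneg {k n : ℕ} (s : Fin n → Fin k) (i : Fin k) : 0 ≤ empirical s i := by
  rw [empirical_eq]; positivity

theorem hellinger_sq {k : ℕ} (p q : Fin k → ℝ) :
    hellinger p q ^ 2 = (∑ i, (√(p i) - √(q i)) ^ 2) / 2 := by
  rw [hellinger, mul_pow, div_pow, Real.sq_sqrt (by positivity),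
    Real.sq_sqrt (Finset.sum_nonneg fun i _ => sq_nonneg _)]
  ring

theorem hellinger_nonneg {k : ℕ} (p q : Fin k → ℝ) : 0 ≤ hellinger p q := by
  rw [hellinger]; positivity

/-- The squared Hellinger distance through the Bhattacharyya coefficient. -/
theorem hellinger_sq_eq_one_sub {k : ℕ} {p q : Fin k → ℝ} (hp : ∀ i, 0 ≤ p i) (hq : ∀ i, 0 ≤ q i)
    (hp1 : ∑ i, p i = 1) (hq1 : ∑ i, q i = 1) :
    hellinger p q ^ 2 = 1 - ∑ i, √(p i) * √(q i) := by
  have : ∀ i, (√(p i) - √(q i)) ^ 2 = p i + q i - 2 * (√(p i) * √(q i)) := fun i => by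
    rw [sub_sq, Real.sq_sqrt (hp i), Real.sq_sqrt (hq i)]; ring
  rw [hellinger_sq, Finset.sum_congr rfl fun i _ => this i, Finset.sum_sub_distrib,
    Finset.sum_add_distrib, hp1, hq1, ← Finset.mul_sum]
  ring

/-- The likelihood of a sample times the exponential of the squared Hellinger distance is at most
the geometric mean of the likelihood and the maximum likelihood. -/
theorem prod_mul_exp_hellinger_le {k n : ℕ} (hn : n ≠ 0) {p : Fin k → ℝ} (hp : ∀ i, 0 ≤ p i)
    (hp1 : ∑ i, p i = 1) (s : Fin n → Fin k) :
    (∏ j, p (s j)) * Real.exp (n * hellinger p (empirical s) ^ 2) * √(n : ℝ) ^ n ≤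
      ∏ i, √(p i * sampleCount s i) ^ sampleCount s i := by
  have hn0 : (0 : ℝ) < n := by positivity
  rw [hellinger_sq_eq_one_sub hp (empirical_nonneg s) hp1 (sum_empirical hn s)]
  have he : (n : ℝ) * (1 - ∑ i, √(p i) * √(empirical s i)) =
      ∑ i, ((sampleCount s i : ℝ) - √(n * p i * sampleCount s i)) := by
    rw [Finset.sum_sub_distrib, ← Nat.cast_sum, sum_sampleCount, mul_sub, mul_one, Finset.mul_sum]
    congr 1
    refine Finset.sum_congr rfl fun i _ => ?_
    rw [empirical_eq, ← Real.sqrt_mul (hp i), ← Real.sqrt_sq hn0.le, ← Real.sqrt_mul (by positivity),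
      Real.sqrt_sq hn0.le]
    congr 1
    field_simp
  have hs : √(n : ℝ) ^ n = ∏ i, √(n : ℝ) ^ sampleCount s i := by
    rw [Finset.prod_pow_eq_pow_sum, sum_sampleCount]
  rw [he, Real.exp_sum, hs, prod_comp_eq_prod_pow_sampleCount, ← Finset.prod_mul_distrib,
    ← Finset.prod_mul_distrib]
  refine Finset.prod_le_prod (fun i _ => ?_) fun i _ => ?_
  · have := hp i
    positivity
  · set N := sampleCount s i
    have hpi := hp i
    have h1 : (N : ℝ) - √(n * p i * N) = N * (1 - √(n * p i * N) / N) := by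
      rcases Nat.eq_zero_or_pos N with h | h
      · simp [h]
      · field_simp
    rw [h1, Real.exp_nat_mul, ← mul_pow, ← mul_pow]
    rcases Nat.eq_zero_or_pos N with h | h
    · simp [h]
    have hN : (0 : ℝ) < N := by positivity
    refine pow_le_pow_left₀ (by positivity) ?_ N
    -- This is t·exp(1 - t) ≤ 1, that is, t ≤ exp(t - 1).
    have h2 : √(n * p i * N) / N * Real.exp (1 - √(n * p i * N) / N) ≤ 1 := by
      have h3 := Real.add_one_le_exp (√(n * p i * N) / N - 1)
      have h4 : Real.exp (1 - √(n * p i * N) / N) * Real.exp (√(n * p i * N) / N - 1) = 1 := by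
        rw [← Real.exp_add]; simp
      refine le_of_le_of_eq ?_ h4
      rw [mul_comm]
      exact mul_le_mul_of_nonneg_left (by linarith) (Real.exp_pos _).le
    have h5 : p i * √(n : ℝ) = √(p i * N) * (√(n * p i * N) / N) := by
      rw [← mul_div_assoc, ← Real.sqrt_mul (by positivity), eq_div_iff hN.ne']
      rw [show p i * N * (n * p i * N) = (p i * N) ^ 2 * n by ring, Real.sqrt_mul (by positivity),
        Real.sqrt_sq (by positivity)]
      ring
    calc _ = √(p i * N) * (√(n * p i * N) / N * Real.exp (1 - √(n * p i * N) / N)) := by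
          rw [← mul_assoc, ← h5]; ring
      _ ≤ _ := mul_le_of_le_one_right (by positivity) h2

/-- An exponential moment bound for the squared Hellinger distance of the empirical mass
function. -/
theorem sum_prod_mul_exp_hellinger_le {k n : ℕ} (hn : n ≠ 0) {p : Fin k → ℝ}
    (hp : ∀ i, 0 ≤ p i) (hp1 : ∑ i, p i = 1) :
    ∑ s : Fin n → Fin k, (∏ j, p (s j)) * Real.exp (n * hellinger p (empirical s) ^ 2) ≤
      4 ^ k := by
  have h := (Finset.sum_le_sum fun s (_ : s ∈ Finset.univ) =>
    prod_mul_exp_hellinger_le hn hp hp1 s).trans (sum_prod_half_le hp hp1 n)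
  rw [← Finset.sum_mul] at h
  have hn0 : (0 : ℝ) < n := by positivity
  exact le_of_mul_le_mul_right h (by positivity)

/-! ### Sample laws and the two-point inequality -/

instance {k : ℕ} (p : FinDistrib k) : IsProbabilityMeasure p.toMeasure where
  measure_univ := by
    simp only [FinDistrib.toMeasure, Measure.coe_finsetSum, Finset.sum_apply, Measure.smul_apply,
      measure_univ, smul_eq_mul, mul_one]
    rw [← ENNReal.ofReal_sum_of_nonneg fun i _ => p.2.1 i, p.2.2, ENNReal.ofReal_one]

instance {k n : ℕ} (p : FinDistrib k) : IsProbabilityMeasure (sampleLaw n p) := by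
  unfold sampleLaw; infer_instance

theorem FinDistrib.toMeasure_singleton {k : ℕ} (p : FinDistrib k) (i : Fin k) :
    p.toMeasure {i} = ENNReal.ofReal (p.1 i) := by
  simp only [FinDistrib.toMeasure, Measure.coe_finsetSum, Finset.sum_apply, Measure.smul_apply,
    smul_eq_mul]
  rw [Finset.sum_eq_single i]
  · simp
  · intro j _ hj
    simp [hj]
  · simp

theorem sampleLaw_singleton {k n : ℕ} (p : FinDistrib k) (s : Fin n → Fin k) :
    sampleLaw n p {s} = ENNReal.ofReal (∏ j, p.1 (s j)) := by
  rw [sampleLaw, Measure.pi_singleton, ENNReal.ofReal_prod_of_nonneg fun j _ => p.2.1 _]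
  simp only [FinDistrib.toMeasure_singleton]

theorem sampleLaw_real_singleton {k n : ℕ} (p : FinDistrib k) (s : Fin n → Fin k) :
    (sampleLaw n p).real {s} = ∏ j, p.1 (s j) := by
  rw [Measure.real, sampleLaw_singleton,
    ENNReal.toReal_ofReal (Finset.prod_nonneg fun j _ => p.2.1 _)]

theorem bind_sampleLaw_real_apply {k n : ℕ} (p : FinDistrib k)
    (κ : Kernel (Fin n → Fin k) (FinDistrib k)) [IsMarkovKernel κ] {B : Set (FinDistrib k)}
    (hB : MeasurableSet B) :
    ((sampleLaw n p).bind κ).real B = ∑ s, (∏ j, p.1 (s j)) * (κ s).real B := by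
  rw [Measure.real, Measure.bind_apply hB κ.measurable.aemeasurable, lintegral_fintype,
    ENNReal.toReal_sum fun s _ => ENNReal.mul_ne_top (measure_ne_top _ _) (measure_ne_top _ _)]
  refine Finset.sum_congr rfl fun s _ => ?_
  rw [ENNReal.toReal_mul, ← sampleLaw_real_singleton, mul_comm]
  rfl

/-- Le Cam's two-point inequality in terms of the Bhattacharyya coefficient. -/
theorem bhattacharyya_pow_le {k n : ℕ} (p q : FinDistrib k)
    (κ : Kernel (Fin n → Fin k) (FinDistrib k)) [IsMarkovKernel κ] {B : Set (FinDistrib k)}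
    (hB : MeasurableSet B) :
    (∑ i, √(p.1 i) * √(q.1 i)) ^ n ≤
      √(((sampleLaw n p).bind κ).real B) + √(((sampleLaw n q).bind κ).real Bᶜ) := by
  have hprod : ∀ (r : FinDistrib k) (s : Fin n → Fin k), 0 ≤ ∏ j, r.1 (s j) :=
    fun r s => Finset.prod_nonneg fun j _ => r.2.1 _
  have hsum : ∀ r : FinDistrib k, ∑ s : Fin n → Fin k, ∏ j, r.1 (s j) = 1 := fun r => by
    rw [← Fintype.sum_pow, r.2.2, one_pow]
  have hsqrt : ∀ (f : Fin n → ℝ), (∀ j, 0 ≤ f j) → ∏ j, √(f j) = √(∏ j, f j) := fun f hf => by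
    rw [Real.sqrt_prod _ fun j _ => hf j]
  have key : ∀ D : Set (FinDistrib k), MeasurableSet D → ∀ r r' : FinDistrib k,
      ∑ s : Fin n → Fin k, √(∏ j, r.1 (s j)) * √(∏ j, r'.1 (s j)) * (κ s).real D ≤
        √(((sampleLaw n r).bind κ).real D) := by
    intro D hD r r'
    -- Cauchy–Schwarz with κ(D) split evenly between the two factors; the factor belonging to `r'`
    -- is then at most 1.
    have h := Real.sum_sqrt_mul_sqrt_le (Finset.univ : Finset (Fin n → Fin k))
      (f := fun s => (∏ j, r.1 (s j)) * (κ s).real D)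
      (g := fun s => (∏ j, r'.1 (s j)) * (κ s).real D)
      (fun s => mul_nonneg (hprod r s) measureReal_nonneg)
      (fun s => mul_nonneg (hprod r' s) measureReal_nonneg)
    have h1 : √(∑ s : Fin n → Fin k, (∏ j, r'.1 (s j)) * (κ s).real D) ≤ 1 := by
      refine Real.sqrt_le_one.2 ?_
      rw [← hsum r']
      exact Finset.sum_le_sum fun s _ => mul_le_of_le_one_right (hprod r' s) measureReal_le_one
    rw [bind_sampleLaw_real_apply r κ hD]
    refine le_trans (le_of_eq ?_) (h.trans (mul_le_of_le_one_right (Real.sqrt_nonneg _) h1))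
    refine Finset.sum_congr rfl fun s _ => ?_
    rw [Real.sqrt_mul (hprod r s), Real.sqrt_mul (hprod r' s)]
    have := Real.mul_self_sqrt (measureReal_nonneg (μ := κ s) (s := D))
    linear_combination (-(√(∏ j, r.1 (s j)) * √(∏ j, r'.1 (s j)))) * this
  rw [Fintype.sum_pow]
  have h1 := key B hB p q
  have h2 := key Bᶜ hB.compl q p
  refine le_trans (le_of_eq ?_) (add_le_add h1 h2)
  rw [← Finset.sum_add_distrib]
  refine Finset.sum_congr rfl fun s _ => ?_
  rw [Finset.prod_mul_distrib, hsqrt _ fun j => p.2.1 _, hsqrt _ fun j => q.2.1 _,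
    probReal_compl_eq_one_sub hB]
  ring

theorem measurable_hellinger {k : ℕ} (p : Fin k → ℝ) :
    Measurable fun q : FinDistrib k => hellinger p q.1 := by
  unfold hellinger
  have h : ∀ i, Measurable fun q : FinDistrib k => q.1 i := fun i =>
    (measurable_pi_apply i).comp measurable_subtype_coe
  exact (Finset.measurable_fun_sum _ fun i _ =>
    (measurable_const.sub (h i).sqrt).pow_const 2).sqrt.const_mul _

/-! ### Assouad's family of paired perturbations -/

/-- The mass `(1 ± g) / (2m)` that the hypothesis `v` puts on a point of `m` pairs. -/
noncomputable def pairMass {m : ℕ} (g : ℝ) (v : Fin m → Bool) (x : Fin m × Bool) : ℝ :=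
  (if x.2 = v x.1 then 1 + g else 1 - g) / (2 * m)

theorem pairMass_nonneg {m : ℕ} {g : ℝ} (hg0 : 0 ≤ g) (hg1 : g ≤ 1) (v : Fin m → Bool)
    (x : Fin m × Bool) : 0 ≤ pairMass g v x := by
  unfold pairMass
  split_ifs
  · positivity
  · exact div_nonneg (by linarith) (by positivity)

theorem sum_bool_pairMass {m : ℕ} (g : ℝ) (v : Fin m → Bool) (a : Fin m) :
    ∑ b, pairMass g v (a, b) = 1 / m := by
  have hm : (m : ℝ) ≠ 0 := by exact_mod_cast (Fin.pos a).ne'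
  rw [Fintype.sum_bool]
  cases h : v a <;> simp [pairMass, h] <;> field_simp <;> ring

theorem sum_pairMass {m : ℕ} (hm : m ≠ 0) (g : ℝ) (v : Fin m → Bool) :
    ∑ x, pairMass g v x = 1 := by
  rw [Fintype.sum_prod_type]
  simp only [sum_bool_pairMass]
  simp [hm]

theorem sum_extend_comp {k m : ℕ} {e : Fin m × Bool → Fin k} (he : Function.Injective e)
    (f : Fin k → ℝ) (hf : ∀ j, j ∉ Set.range e → f j = 0) : ∑ j, f j = ∑ x, f (e x) :=
  (Fintype.sum_of_injective e he (fun x => f (e x)) f hf fun _ => rfl).symm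

/-- The hypotheses of Assouad's lemma: perturbations of the uniform distribution on `m` pairs. -/
noncomputable def pairDistrib {k m : ℕ} (hm : m ≠ 0) {e : Fin m × Bool → Fin k}
    (he : Function.Injective e) {g : ℝ} (hg0 : 0 ≤ g) (hg1 : g ≤ 1) (v : Fin m → Bool) :
    FinDistrib k :=
  ⟨Function.extend e (pairMass g v) 0, by
    refine ⟨fun j => ?_, ?_⟩
    · by_cases h : ∃ x, e x = j
      · obtain ⟨x, rfl⟩ := h
        rw [he.extend_apply]
        exact pairMass_nonneg hg0 hg1 v x
      · rw [Function.extend_apply' _ _ _ h]; rfl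
    · rw [sum_extend_comp he _ fun j hj => by rw [Function.extend_apply' _ _ _ hj]; rfl]
      simp only [he.extend_apply]
      exact sum_pairMass hm g v⟩

section Assouad

variable {k m : ℕ} (hm : m ≠ 0) {e : Fin m × Bool → Fin k} (he : Function.Injective e) {g : ℝ}
  (hg0 : 0 ≤ g) (hg1 : g ≤ 1)

theorem pairDistrib_apply (v : Fin m → Bool) (x : Fin m × Bool) :
    (pairDistrib hm he hg0 hg1 v).1 (e x) = pairMass g v x :=
  he.extend_apply _ _ _

theorem pairDistrib_apply_of_notMem (v : Fin m → Bool) {j : Fin k} (hj : j ∉ Set.range e) :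
    (pairDistrib hm he hg0 hg1 v).1 j = 0 :=
  Function.extend_apply' _ _ _ hj

/-- Flip the bit `a`. -/
def flipBit (a : Fin m) (v : Fin m → Bool) : Fin m → Bool := Function.update v a (!v a)

theorem flipBit_involutive (a : Fin m) : Function.Involutive (flipBit a) := by
  intro v
  simp [flipBit]

theorem one_sub_le_sum_sqrt_mul_sqrt_flipBit (a : Fin m) (v : Fin m → Bool) :
    1 - g ^ 2 / m ≤ ∑ j, √((pairDistrib hm he hg0 hg1 v).1 j) *
      √((pairDistrib hm he hg0 hg1 (flipBit a v)).1 j) := by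
  have hm0 : (0 : ℝ) < m := by positivity
  rw [sum_extend_comp he _ fun j hj => by rw [pairDistrib_apply_of_notMem hm he hg0 hg1 v hj]; simp]
  simp only [pairDistrib_apply]
  rw [Fintype.sum_prod_type]
  have h : ∀ i, 1 / (m : ℝ) - (if i = a then g ^ 2 / m else 0) ≤
      ∑ b, √(pairMass g v (i, b)) * √(pairMass g (flipBit a v) (i, b)) := by
    intro i
    by_cases hi : i = a
    · subst hi
      have h1 : ∀ b, √(pairMass g v (i, b)) * √(pairMass g (flipBit i v) (i, b)) =
          √(1 - g ^ 2) / (2 * m) := by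
        intro b
        rw [← Real.sqrt_mul (pairMass_nonneg hg0 hg1 v _)]
        have : pairMass g v (i, b) * pairMass g (flipBit i v) (i, b) =
            (1 - g ^ 2) / (2 * m) ^ 2 := by
          cases b <;> cases h : v i <;> simp [pairMass, flipBit, h] <;> field_simp <;> ring
        rw [this, Real.sqrt_div' _ (by positivity), Real.sqrt_sq (by positivity)]
      have h2 : 1 - g ^ 2 ≤ √(1 - g ^ 2) := by
        refine Real.le_sqrt_of_sq_le ?_
        nlinarith [sq_nonneg g, mul_nonneg hg0 hg0, mul_le_one₀ hg1 hg0 hg1]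
      simp only [h1, if_true, Fintype.sum_bool]
      have h3 := div_le_div_of_nonneg_right h2 hm0.le
      calc _ = (1 - g ^ 2) / m := by ring
        _ ≤ _ := h3
        _ = _ := by field_simp; ring
    · have h1 : ∀ b, √(pairMass g v (i, b)) * √(pairMass g (flipBit a v) (i, b)) =
          pairMass g v (i, b) := by
        intro b
        have : pairMass g (flipBit a v) (i, b) = pairMass g v (i, b) := by
          simp [pairMass, flipBit, hi]
        rw [this, Real.mul_self_sqrt (pairMass_nonneg hg0 hg1 v _)]
      simp only [h1, sum_bool_pairMass, if_neg hi, sub_zero, le_refl]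
  refine le_trans (le_of_eq ?_) (Finset.sum_le_sum fun i _ => h i)
  rw [Finset.sum_sub_distrib, Finset.sum_ite_eq' Finset.univ a]
  simp [hm]

/-- The outputs that order the pair `a` against the bit `v a`. -/
def wrongSet (e : Fin m × Bool → Fin k) (v : Fin m → Bool) (a : Fin m) : Set (FinDistrib k) :=
  if v a then {q | q.1 (e (a, true)) ≤ q.1 (e (a, false))}
  else {q | q.1 (e (a, true)) ≤ q.1 (e (a, false))}ᶜ

theorem measurableSet_wrongSet (v : Fin m → Bool) (a : Fin m) :
    MeasurableSet (wrongSet e v a) := by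
  have h : ∀ i, Measurable fun q : FinDistrib k => q.1 i := fun i =>
    (measurable_pi_apply i).comp measurable_subtype_coe
  unfold wrongSet
  split_ifs
  · exact measurableSet_le (h _) (h _)
  · exact (measurableSet_le (h _) (h _)).compl

/-- Ties count as wrong only for the bit `true`. This asymmetry makes the two wrong sets exact
complements, so one event tests both hypotheses. -/
theorem wrongSet_flipBit (v : Fin m → Bool) (a : Fin m) :
    wrongSet e (flipBit a v) a = (wrongSet e v a)ᶜ := by
  cases h : v a <;> simp [wrongSet, flipBit, h]

/-- Write a ≥ b for the two roots. As x ≤ y, (a - x) - (b - y) ≥ a - b, so the sum of squares is at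
least (a - b)² / 2. Finally √(1 - g²) ≤ 1 - g²/2 bounds a b. -/
theorem sq_sub_sqrt_pair_ge (hm : m ≠ 0) (hg0 : 0 ≤ g) (hg1 : g ≤ 1) {x y : ℝ} (hxy : x ≤ y) :
    g ^ 2 / (4 * m) ≤ (√((1 + g) / (2 * m)) - x) ^ 2 + (√((1 - g) / (2 * m)) - y) ^ 2 := by
  have hm0 : (0 : ℝ) < m := by positivity
  have hab : √((1 - g) / (2 * m)) ≤ √((1 + g) / (2 * m)) :=
    Real.sqrt_le_sqrt (div_le_div_of_nonneg_right (by linarith) (by positivity))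
  have ha := Real.sq_sqrt (show 0 ≤ (1 + g) / (2 * m) by positivity)
  have hb := Real.sq_sqrt (show 0 ≤ (1 - g) / (2 * m) from div_nonneg (by linarith) (by positivity))
  have hp : √((1 + g) / (2 * m)) * √((1 - g) / (2 * m)) ≤ (1 - g ^ 2 / 2) / (2 * m) := by
    rw [← Real.sqrt_mul (by positivity)]
    refine Real.sqrt_le_iff.2 ⟨div_nonneg (by nlinarith) (by positivity), ?_⟩
    rw [div_mul_div_comm, div_pow, ← sq (2 * (m : ℝ))]
    exact div_le_div_of_nonneg_right (by nlinarith [sq_nonneg (g ^ 2)]) (by positivity)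
  set a := √((1 + g) / (2 * m))
  set b := √((1 - g) / (2 * m))
  have h1 : (a - b) ^ 2 / 2 ≤ (a - x) ^ 2 + (b - y) ^ 2 := by
    nlinarith [sq_nonneg ((a - x) + (b - y)), mul_nonneg (sub_nonneg.2 hab) (sub_nonneg.2 hxy)]
  refine le_trans ?_ h1
  have h2 : g ^ 2 / (4 * m) =
      ((1 + g) / (2 * m) + (1 - g) / (2 * m) - 2 * ((1 - g ^ 2 / 2) / (2 * m))) / 2 := by
    field_simp; ring
  rw [h2]
  nlinarith

/-- Each wrongly ordered pair contributes to the squared Hellinger distance. -/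
theorem sum_indicator_wrongSet_le (v : Fin m → Bool) (q : FinDistrib k) :
    (∑ a, (wrongSet e v a).indicator (fun _ => (1 : ℝ)) q) * (g ^ 2 / (8 * m)) ≤
      hellinger (pairDistrib hm he hg0 hg1 v).1 q.1 ^ 2 := by
  rw [hellinger_sq]
  have h1 : ∑ x, (√(pairMass g v x) - √(q.1 (e x))) ^ 2 ≤
      ∑ j, (√((pairDistrib hm he hg0 hg1 v).1 j) - √(q.1 j)) ^ 2 := by
    simp only [← pairDistrib_apply hm he hg0 hg1]
    rw [← Finset.sum_image (s := Finset.univ) (g := e) he.injOn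
      (f := fun j => (√((pairDistrib hm he hg0 hg1 v).1 j) - √(q.1 j)) ^ 2)]
    exact Finset.sum_le_sum_of_subset_of_nonneg (Finset.subset_univ _) fun _ _ _ => sq_nonneg _
  have h2 : (∑ a, (wrongSet e v a).indicator (fun _ => (1 : ℝ)) q) * (g ^ 2 / (4 * m)) ≤
      ∑ x, (√(pairMass g v x) - √(q.1 (e x))) ^ 2 := by
    rw [Fintype.sum_prod_type, Finset.sum_mul]
    refine Finset.sum_le_sum fun a _ => ?_
    rw [Fintype.sum_bool]
    by_cases hq : q ∈ wrongSet e v a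
    · rw [Set.indicator_of_mem hq, one_mul]
      cases h : v a
      · simp only [wrongSet, h, Bool.false_eq_true, if_false, Set.mem_compl_iff, Set.mem_ofPred_eq,
          not_le] at hq
        have := sq_sub_sqrt_pair_ge hm hg0 hg1 (Real.sqrt_le_sqrt hq.le)
        simpa [pairMass, h, add_comm] using this
      · simp only [wrongSet, h, if_true, Set.mem_ofPred_eq] at hq
        have := sq_sub_sqrt_pair_ge hm hg0 hg1 (Real.sqrt_le_sqrt hq)
        simpa [pairMass, h] using this
    · rw [Set.indicator_of_notMem hq, zero_mul]
      positivity
  have h3 : g ^ 2 / (8 * m) = g ^ 2 / (4 * m) / 2 := by ring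
  rw [h3]
  linarith

end Assouad

/-! ### Lower bounds on the sample size of a learner -/

instance {k n : ℕ} (p : FinDistrib k) (κ : Kernel (Fin n → Fin k) (FinDistrib k))
    [IsMarkovKernel κ] : IsProbabilityMeasure ((sampleLaw n p).bind κ) where
  measure_univ := by
    rw [Measure.bind_apply MeasurableSet.univ κ.measurable.aemeasurable]
    simp

/-- The guarantee of a learner of accuracy `ε` and failure probability `δ`. -/
def IsLearner {k n : ℕ} (ε δ : ℝ) (κ : Kernel (Fin n → Fin k) (FinDistrib k)) : Prop :=
  ∀ p : FinDistrib k, ENNReal.ofReal (1 - δ) ≤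
    ((sampleLaw n p).bind κ) {q : FinDistrib k | hellinger p.1 q.1 ≤ ε}

theorem measurableSet_hellinger_le {k : ℕ} (p : Fin k → ℝ) (ε : ℝ) :
    MeasurableSet {q : FinDistrib k | hellinger p q.1 ≤ ε} :=
  measurableSet_le (measurable_hellinger p) measurable_const

theorem IsLearner.failure_le {k n : ℕ} {ε δ : ℝ} {κ : Kernel (Fin n → Fin k) (FinDistrib k)}
    [IsMarkovKernel κ] (h : IsLearner ε δ κ) (p : FinDistrib k) :
    ((sampleLaw n p).bind κ).real {q : FinDistrib k | hellinger p.1 q.1 ≤ ε}ᶜ ≤ δ := by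
  have h1 := (ENNReal.ofReal_le_iff_le_toReal (measure_ne_top _ _)).1 (h p)
  rw [probReal_compl_eq_one_sub (measurableSet_hellinger_le _ _), Measure.real]
  linarith

section Assouad

variable {k m n : ℕ} (hm : m ≠ 0) {e : Fin m × Bool → Fin k} (he : Function.Injective e)
  {ε δ : ℝ} (hε : 0 < ε) (hg : 12 * ε ≤ 1) (κ : Kernel (Fin n → Fin k) (FinDistrib k))
  [IsMarkovKernel κ]

/-- The expected number of wrongly ordered pairs for a learner. -/
theorem IsLearner.sum_wrongSet_le (h : IsLearner ε δ κ) (v : Fin m → Bool) :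
    ∑ a, ((sampleLaw n (pairDistrib hm he (by positivity) hg v)).bind κ).real (wrongSet e v a) ≤
      m / 18 + m * δ := by
  set p := pairDistrib hm he (by positivity) hg v with hp
  set μ := (sampleLaw n p).bind κ
  set D := {q : FinDistrib k | hellinger p.1 q.1 ≤ ε} with hD
  have hm0 : (0 : ℝ) < m := by positivity
  have hDm : MeasurableSet D := measurableSet_hellinger_le _ _
  -- On success each wrong pair costs (12 ε)² / (8m) = 18 ε² / m out of a budget ε², so at most m/18
  -- pairs are wrong; on failure at most all m are.
  have hpt : ∀ q, ∑ a, (wrongSet e v a).indicator (fun _ => (1 : ℝ)) q ≤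
      m / 18 + m * Dᶜ.indicator (fun _ => (1 : ℝ)) q := by
    intro q
    by_cases hq : q ∈ D
    · rw [Set.indicator_of_notMem (by simpa using hq), mul_zero, add_zero]
      have h1 := sum_indicator_wrongSet_le hm he (by positivity : 0 ≤ 12 * ε) hg v q
      have h2 : hellinger p.1 q.1 ^ 2 ≤ ε ^ 2 := pow_le_pow_left₀ (hellinger_nonneg _ _) hq 2
      rw [← hp] at h1
      have h3 : (12 * ε) ^ 2 / (8 * m) = ε ^ 2 * (18 / m) := by field_simp; norm_num
      rw [h3] at h1
      have h4 := h1.trans h2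
      have h5 : (∑ a, (wrongSet e v a).indicator (fun _ => (1 : ℝ)) q) * (18 / m) ≤ 1 := by
        refine le_of_mul_le_mul_left ?_ (by positivity : 0 < ε ^ 2)
        linarith
      rw [← mul_div_assoc, div_le_one hm0] at h5
      linarith
    · rw [Set.indicator_of_mem (by simpa using hq)]
      have : ∑ a, (wrongSet e v a).indicator (fun _ => (1 : ℝ)) q ≤ ∑ _a : Fin m, (1 : ℝ) :=
        Finset.sum_le_sum fun a _ => Set.indicator_le_self' (fun _ _ => zero_le_one) q
      simp at this
      linarith
  have hint : ∀ B : Set (FinDistrib k), MeasurableSet B →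
      Integrable (B.indicator fun _ => (1 : ℝ)) μ := fun B hB =>
    (integrable_const _).indicator hB
  have hi := integral_mono (μ := μ)
    (integrable_finsetSum _ fun a _ => hint _ (measurableSet_wrongSet v a))
    ((integrable_const _).add ((hint _ hDm.compl).const_mul _)) hpt
  rw [integral_finsetSum _ fun a _ => hint _ (measurableSet_wrongSet v a)] at hi
  simp only [Pi.add_apply] at hi
  rw [integral_add (integrable_const _) ((hint _ hDm.compl).const_mul _),
    integral_const_mul, integral_indicator_const _ hDm.compl] at hi
  simp only [integral_indicator_const _ (measurableSet_wrongSet v _), integral_const,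
    probReal_univ, smul_eq_mul, mul_one, one_mul] at hi
  refine hi.trans ?_
  have := h.failure_le p
  gcongr

/-- The Bernoulli-type consequence of the two-point inequality for one bit. -/
theorem pow_le_two_mul_wrongSet (v : Fin m → Bool) (a : Fin m) :
    ((1 - (12 * ε) ^ 2 / m) ^ n) ^ 2 ≤
      2 * (((sampleLaw n (pairDistrib hm he (by positivity) hg v)).bind κ).real (wrongSet e v a) +
      ((sampleLaw n (pairDistrib hm he (by positivity) hg (flipBit a v))).bind κ).real
        (wrongSet e (flipBit a v) a)) := by
  have hm1 : (1 : ℝ) ≤ m := by exact_mod_cast Nat.one_le_iff_ne_zero.2 hm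
  have h0 : 0 ≤ 1 - (12 * ε) ^ 2 / m := by
    rw [sub_nonneg, div_le_one (by linarith)]
    have : (12 * ε) ^ 2 ≤ 1 := pow_le_one₀ (by positivity) hg
    linarith
  have h1 := one_sub_le_sum_sqrt_mul_sqrt_flipBit hm he (by positivity : 0 ≤ 12 * ε) hg a v
  have h2 := bhattacharyya_pow_le (pairDistrib hm he (by positivity) hg v)
    (pairDistrib hm he (by positivity) hg (flipBit a v)) κ (measurableSet_wrongSet (e := e) v a)
  rw [← wrongSet_flipBit] at h2
  have h3 := (pow_le_pow_left₀ h0 h1 n).trans h2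
  have h4 := pow_le_pow_left₀ (pow_nonneg h0 n) h3 2
  refine h4.trans (add_sq_le.trans (le_of_eq ?_))
  rw [Real.sq_sqrt measureReal_nonneg, Real.sq_sqrt measureReal_nonneg]

/-- Assouad's bound on the number of samples of a learner. -/
theorem IsLearner.card_pairs_le (h : IsLearner ε δ κ) (hε : 0 < ε) (hg : 12 * ε ≤ 1)
    (hm : m ≠ 0) (he : Function.Injective e) (hδ : δ ≤ 1 / 18) : (m : ℝ) ≤ 432 * (n * ε ^ 2) := by
  have hm0 : (0 : ℝ) < m := by positivity
  set M : (Fin m → Bool) → Fin m → ℝ := fun v a =>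
    ((sampleLaw n (pairDistrib hm he (by positivity) hg v)).bind κ).real (wrongSet e v a) with hM
  have h1 : ∑ v, ∑ a, M v a ≤ ∑ _v : Fin m → Bool, (m : ℝ) / 9 := by
    refine Finset.sum_le_sum fun v _ => (h.sum_wrongSet_le hm he hε hg κ v).trans ?_
    nlinarith
  have h2 : ∑ _v : Fin m → Bool, (m : ℝ) * ((1 - (12 * ε) ^ 2 / m) ^ n) ^ 2 ≤
      4 * ∑ v, ∑ a, M v a := by
    rw [Finset.sum_comm (f := M)]
    have hflip : ∀ a, ∑ v, M (flipBit a v) a = ∑ v, M v a := fun a =>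
      Equiv.sum_comp (flipBit_involutive a).toPerm fun v => M v a
    have h3 : ∀ a, ∑ _v : Fin m → Bool, ((1 - (12 * ε) ^ 2 / m) ^ n) ^ 2 ≤ 4 * ∑ v, M v a := by
      intro a
      have := Finset.sum_le_sum fun v (_ : v ∈ Finset.univ) =>
        pow_le_two_mul_wrongSet hm he hε hg κ v a
      rw [← Finset.mul_sum, Finset.sum_add_distrib] at this
      have h4 := hflip a
      simp only [hM] at h4 ⊢
      rw [h4] at this
      linarith
    have h5 := Finset.sum_le_sum fun a (_ : a ∈ Finset.univ) => h3 a
    rw [← Finset.mul_sum] at h5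
    refine le_trans (le_of_eq ?_) h5
    simp
    ring
  -- Averaged over `v`, the expected number of wrong pairs is at most m/9, and 4/9 = (2/3)².
  have h3 : ((1 - (12 * ε) ^ 2 / m) ^ n) ^ 2 ≤ (2 / 3) ^ 2 := by
    have h4 := h2.trans (mul_le_mul_of_nonneg_left h1 (by norm_num))
    rw [Finset.sum_const, Finset.sum_const, nsmul_eq_mul, nsmul_eq_mul] at h4
    have hc : (0 : ℝ) < (Finset.univ : Finset (Fin m → Bool)).card := by
      exact_mod_cast Finset.card_pos.2 Finset.univ_nonempty
    have h5 : (Finset.univ : Finset (Fin m → Bool)).card * (m : ℝ) *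
        ((1 - (12 * ε) ^ 2 / m) ^ n) ^ 2 ≤
        (Finset.univ : Finset (Fin m → Bool)).card * (m : ℝ) * (2 / 3) ^ 2 := by linarith
    exact le_of_mul_le_mul_left h5 (by positivity)
  have h4 := le_of_sq_le_sq h3 (by norm_num)
  have h6 : (12 * ε) ^ 2 / m ≤ 1 := by
    rw [div_le_one hm0]
    have : (12 * ε) ^ 2 ≤ 1 := pow_le_one₀ (by positivity) hg
    have hm1 : (1 : ℝ) ≤ m := by exact_mod_cast Nat.one_le_iff_ne_zero.2 hm
    linarith
  -- Bernoulli's inequality forces n·144 ε² / m ≥ 1/3, whence 432 = 3·144.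
  have h5 := one_add_mul_le_pow (a := -((12 * ε) ^ 2 / m)) (by linarith) n
  rw [← sub_eq_add_neg] at h5
  have h7 : 1 / 3 ≤ n * ((12 * ε) ^ 2 / m) := by linarith
  rw [← mul_div_assoc, le_div_iff₀ hm0] at h7
  nlinarith

/-- Le Cam's bound on the number of samples of a learner. -/
theorem IsLearner.log_le {e : Fin 1 × Bool → Fin k} (h : IsLearner ε δ κ) (hε : 0 < ε)
    (hg : ε ≤ 1 / 20) (he : Function.Injective e) (hδ0 : 0 < δ) (hδ : δ ≤ 1 / 18) :
    Real.log (1 / δ) ≤ 1152 * (n * ε ^ 2) := by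
  have hg' : 12 * ε ≤ 1 := by linarith
  have hw : ∀ v : Fin 1 → Bool,
      ((sampleLaw n (pairDistrib one_ne_zero he (by positivity) hg' v)).bind κ).real
        (wrongSet e v 0) ≤ δ := by
    intro v
    refine (measureReal_mono ?_).trans (h.failure_le _)
    -- With a single pair, a wrong order already forces H² ≥ 18 ε², so it is a failure of the
    -- learner.
    intro q hq hD
    have h1 := sum_indicator_wrongSet_le one_ne_zero he (by positivity : 0 ≤ 12 * ε) hg' v q
    have h2 : hellinger _ q.1 ^ 2 ≤ ε ^ 2 := pow_le_pow_left₀ (hellinger_nonneg _ _) hD 2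
    have h3 := h1.trans h2
    simp only [Finset.univ_unique, Fin.default_eq_zero, Finset.sum_singleton,
      Set.indicator_of_mem hq, Nat.cast_one] at h3
    nlinarith [sq_pos_of_pos hε]
  have h1 := pow_le_two_mul_wrongSet one_ne_zero he hε hg' κ (fun _ => true) 0
  have h2 : ((1 - (12 * ε) ^ 2) ^ n) ^ 2 ≤ 4 * δ := by
    have := hw (fun _ => true)
    have := hw (flipBit 0 fun _ => true)
    simp only [Nat.cast_one, div_one] at h1
    linarith
  -- On x ≤ 1/2 one has log(1 - x) ≥ -2x; here ε ≤ 1/20 gives x = (12 ε)² ≤ 9/25.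
  have hb : 1 / 2 ≤ 1 - (12 * ε) ^ 2 := by nlinarith
  have h3 := Real.log_le_log (by positivity) h2
  rw [← pow_mul, Real.log_pow, Real.log_mul (by norm_num) hδ0.ne'] at h3
  have h4 := Real.one_sub_inv_le_log_of_pos (show 0 < 1 - (12 * ε) ^ 2 by linarith)
  have h5 : -(2 * (12 * ε) ^ 2) ≤ 1 - (1 - (12 * ε) ^ 2)⁻¹ := by
    have : (1 - (12 * ε) ^ 2)⁻¹ ≤ 1 + 2 * (12 * ε) ^ 2 := by
      rw [inv_le_iff_one_le_mul₀ (by linarith)]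
      nlinarith [sq_nonneg (12 * ε)]
    linarith
  -- Since δ ≤ 1/18 < 1/16, log 4 is at most half of log(1/δ); absorbing it doubles 4·144 = 576 to
  -- 1152.
  have h6 : Real.log δ ≤ -(2 * Real.log 4) := by
    have h7 := Real.log_le_log hδ0 (hδ.trans (by norm_num : (1 / 18 : ℝ) ≤ (4 ^ 2)⁻¹))
    rw [Real.log_inv, Real.log_pow] at h7
    exact_mod_cast h7
  rw [one_div, Real.log_inv]
  have h8 := mul_le_mul_of_nonneg_left (h5.trans h4) (by positivity : (0 : ℝ) ≤ n * 2)
  push_cast at h3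
  nlinarith

end Assouad

theorem Learnable.lower_bound {k n : ℕ} {ε δ : ℝ} (h : Learnable k hellinger ε δ n) (hk : 2 ≤ k)
    (hε : 0 < ε) (hε' : ε ≤ 1 / 20) (hδ0 : 0 < δ) (hδ : δ ≤ 1 / 18) :
    1 / 2592 * ((k + Real.log (1 / δ)) / ε ^ 2) ≤ n := by
  obtain ⟨κ, hκ, hl⟩ := h
  have hl : IsLearner ε δ κ := hl
  have emb : ∀ m, 2 * m ≤ k → ∃ e : Fin m × Bool → Fin k, Function.Injective e := fun m hm => by
    obtain ⟨e⟩ := Function.Embedding.nonempty_of_card_le (α := Fin m × Bool) (β := Fin k)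
      (by simp; omega)
    exact ⟨e, e.injective⟩
  obtain ⟨e₁, he₁⟩ := emb (k / 2) (by omega)
  obtain ⟨e₂, he₂⟩ := emb 1 (by omega)
  have h1 := hl.card_pairs_le κ hε (by linarith) (by omega) he₁ hδ
  have h2 := hl.log_le κ hε hε' he₂ hδ0 hδ
  have h3 : (k : ℝ) ≤ 3 * (k / 2 : ℕ) := by
    have : k ≤ 3 * (k / 2) := by omega
    exact_mod_cast this
  -- The total is 3·432 + 1152 = 2448 ≤ 2592.
  rw [← mul_div_assoc, div_le_iff₀ (by positivity)]
  have : 0 ≤ n * ε ^ 2 := by positivity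
  linarith

/-! ### Concentration of the empirical law and sample complexity -/

/-- The concentration of the empirical mass function in Hellinger distance. -/
theorem sampleLaw_hellinger_empirical_le {k n : ℕ} {ε δ : ℝ} (hn0 : n ≠ 0) (hδ : 0 < δ)
    (hε : 0 ≤ ε) (hn : 2 * k + Real.log (1 / δ) ≤ n * ε ^ 2) (p : FinDistrib k) :
    ENNReal.ofReal (1 - δ) ≤ sampleLaw n p {s | hellinger p.1 (empirical s) ≤ ε} := by
  classical
  set A : Set (Fin n → Fin k) := {s | hellinger p.1 (empirical s) ≤ ε} with hA
  have hAm : MeasurableSet A := A.toFinite.measurableSet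
  rw [ENNReal.ofReal_le_iff_le_toReal (measure_ne_top _ _)]
  change 1 - δ ≤ (sampleLaw n p).real A
  have hc := probReal_compl_eq_one_sub (μ := sampleLaw n p) hAm
  suffices hs : (sampleLaw n p).real Aᶜ ≤ δ by linarith
  have h0 : ∀ s : Fin n → Fin k, 0 ≤ ∏ j, p.1 (s j) := fun s =>
    Finset.prod_nonneg fun j _ => p.2.1 _
  -- Markov's inequality for exp(n H²).
  have h1 : (sampleLaw n p).real Aᶜ * Real.exp (n * ε ^ 2) ≤ 4 ^ k := by
    refine le_trans ?_ (sum_prod_mul_exp_hellinger_le hn0 p.2.1 p.2.2)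
    have : (sampleLaw n p).real Aᶜ = ∑ s ∈ Finset.univ.filter (· ∈ Aᶜ), ∏ j, p.1 (s j) := by
      simp only [← sampleLaw_real_singleton]
      rw [sum_measureReal_singleton]
      congr 1
      ext s
      simp
    rw [this, Finset.sum_mul]
    refine (Finset.sum_le_sum fun s hs => mul_le_mul_of_nonneg_left (Real.exp_le_exp.2 ?_)
      (h0 s)).trans (Finset.sum_le_sum_of_subset_of_nonneg (Finset.filter_subset _ _)
        fun s _ _ => mul_nonneg (h0 s) (Real.exp_pos _).le)
    have hs' : ε < hellinger p.1 (empirical s) := by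
      simpa [hA] using (Finset.mem_filter.1 hs).2
    gcongr
  have h2 : (4 : ℝ) ^ k ≤ δ * Real.exp (n * ε ^ 2) := by
    have h3 : Real.exp (2 * k) * (1 / δ) ≤ Real.exp (n * ε ^ 2) := by
      rw [← Real.exp_log (by positivity : 0 < 1 / δ), ← Real.exp_add]
      exact Real.exp_le_exp.2 hn
    -- The coefficient 2 of `k` in the hypothesis comes from 4 ≤ e².
    have h4 : (4 : ℝ) ^ k ≤ Real.exp (2 * k) := by
      rw [mul_comm, Real.exp_nat_mul]
      refine pow_le_pow_left₀ (by norm_num) ?_ k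
      rw [show (2 : ℝ) = 1 + 1 by norm_num, Real.exp_add]
      nlinarith [Real.add_one_le_exp (1 : ℝ)]
    rw [mul_one_div, div_le_iff₀ hδ] at h3
    linarith
  exact le_of_mul_le_mul_right (h1.trans h2) (Real.exp_pos _)

theorem learnable_of_empirical {k n : ℕ} {ε δ : ℝ} (hn0 : n ≠ 0)
    (h : ∀ p : FinDistrib k,
      ENNReal.ofReal (1 - δ) ≤ sampleLaw n p {s | hellinger p.1 (empirical s) ≤ ε}) :
    Learnable k hellinger ε δ n := by
  set f : (Fin n → Fin k) → FinDistrib k := fun s =>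
    ⟨empirical s, empirical_nonneg s, sum_empirical hn0 s⟩
  have hf : Measurable f := measurable_of_countable f
  refine ⟨Kernel.deterministic f hf, inferInstance, fun p => ?_⟩
  rw [Measure.deterministic_comp_eq_map, Measure.map_apply hf (measurableSet_hellinger_le _ _)]
  exact h p

theorem hellinger_le_one {k : ℕ} (p q : FinDistrib k) : hellinger p.1 q.1 ≤ 1 := by
  have h := hellinger_sq_eq_one_sub p.2.1 q.2.1 p.2.2 q.2.2
  have h1 : 0 ≤ ∑ i, √(p.1 i) * √(q.1 i) := Finset.sum_nonneg fun i _ => by positivity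
  nlinarith [hellinger_nonneg p.1 q.1]

theorem learnable_zero {k : ℕ} (hk : 1 ≤ k) {ε δ : ℝ} (hε : 1 ≤ ε) (hδ : 0 < δ) :
    Learnable k hellinger ε δ 0 := by
  have : NeZero k := ⟨by omega⟩
  refine ⟨Kernel.const _ (Measure.dirac (⟨Pi.single 0 1, single_mem_stdSimplex ℝ 0⟩)),
    inferInstance, fun p => ?_⟩
  have : {q : FinDistrib k | hellinger p.1 q.1 ≤ ε} = Set.univ :=
    Set.eq_univ_of_forall fun q => (hellinger_le_one p q).trans hε
  rw [this, measure_univ]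
  exact ENNReal.ofReal_le_one.2 (by linarith)

theorem sampleComplexity_le {k n : ℕ} {d : (Fin k → ℝ) → (Fin k → ℝ) → ℝ} {ε δ : ℝ}
    (h : Learnable k d ε δ n) : (sampleComplexity k d ε δ : ENNReal) ≤ n := by
  have : sampleComplexity k d ε δ ≤ n := iInf₂_le n h
  exact_mod_cast ENat.toENNReal_le.2 this

theorem le_sampleComplexity {k : ℕ} {d : (Fin k → ℝ) → (Fin k → ℝ) → ℝ} {ε δ x : ℝ}
    (h : ∀ n, Learnable k d ε δ n → x ≤ n) :
    ENNReal.ofReal x ≤ (sampleComplexity k d ε δ : ENNReal) := by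
  have h1 : (⌈x⌉₊ : ℕ∞) ≤ sampleComplexity k d ε δ :=
    le_iInf₂ fun n hn => by exact_mod_cast Nat.ceil_le.2 (h n hn)
  refine le_trans ?_ (ENat.toENNReal_le.2 h1)
  rw [ENat.toENNReal_coe, ← ENNReal.ofReal_natCast]
  exact ENNReal.ofReal_le_ofReal (Nat.le_ceil x)

theorem mainTheorem2 :
    ∃ c C ε₀ δ₀ : ℝ, 0 < c ∧ 0 < C ∧ 0 < ε₀ ∧ 0 < δ₀ ∧
      -- lower bound, against every (possibly randomized) learner
      (∀ (k : ℕ) (ε δ : ℝ), 2 ≤ k → 0 < ε → ε ≤ ε₀ → 0 < δ → δ ≤ δ₀ →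
        ENNReal.ofReal (c * (((k : ℝ) + Real.log (1 / δ)) / ε ^ 2)) ≤
          (sampleComplexity k hellinger ε δ : ENNReal)) ∧
      -- upper bound
      (∀ (k : ℕ) (ε δ : ℝ), 1 ≤ k → 0 < ε → 0 < δ → δ ≤ 1 →
        (sampleComplexity k hellinger ε δ : ENNReal) ≤
          ENNReal.ofReal (C * (((k : ℝ) + Real.log (1 / δ)) / ε ^ 2))) ∧
      -- the empirical distribution attains the upper bound
      (∀ (k : ℕ) (ε δ : ℝ), 1 ≤ k → 0 < ε → 0 < δ → δ ≤ 1 →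
        ∀ n : ℕ, C * (((k : ℝ) + Real.log (1 / δ)) / ε ^ 2) ≤ (n : ℝ) →
          ∀ p : FinDistrib k,
            ENNReal.ofReal (1 - δ) ≤
              sampleLaw n p {s | hellinger p.1 (empirical s) ≤ ε}) := by
  have hemp : ∀ (k : ℕ) (ε δ : ℝ), 1 ≤ k → 0 < ε → 0 < δ → δ ≤ 1 →
      ∀ n : ℕ, 2 * (((k : ℝ) + Real.log (1 / δ)) / ε ^ 2) ≤ (n : ℝ) →
        n ≠ 0 ∧ ∀ p : FinDistrib k,
          ENNReal.ofReal (1 - δ) ≤ sampleLaw n p {s | hellinger p.1 (empirical s) ≤ ε} := by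
    intro k ε δ hk hε hδ hδ1 n hn
    have hk1 : (1 : ℝ) ≤ k := by exact_mod_cast hk
    have hl : 0 ≤ Real.log (1 / δ) := Real.log_nonneg (by rwa [le_div_iff₀ hδ, one_mul])
    have hn0 : n ≠ 0 := by
      rintro rfl
      have : 0 < 2 * (((k : ℝ) + Real.log (1 / δ)) / ε ^ 2) := by positivity
      rw [Nat.cast_zero] at hn
      linarith
    refine ⟨hn0, sampleLaw_hellinger_empirical_le hn0 hδ hε.le ?_⟩
    rw [← mul_div_assoc, div_le_iff₀ (by positivity)] at hn
    linarith
  refine ⟨1 / 2592, 4, 1 / 20, 1 / 18, by norm_num, by norm_num, by norm_num, by norm_num,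
    fun k ε δ hk hε hε' hδ hδ' => le_sampleComplexity fun n hn => hn.lower_bound hk hε hε' hδ hδ',
    fun k ε δ hk hε hδ hδ1 => ?_, fun k ε δ hk hε hδ hδ1 n hn => ?_⟩
  -- For large ε the bound can drop below 1, but H ≤ 1 lets a constant guess succeed with no
  -- samples. For ε < 1 the ratio x is at least 1 and absorbs the rounding: ⌈2x⌉ ≤ 2x + 1 ≤ 4x.
  · rcases le_or_gt 1 ε with hε1 | hε1
    · exact (sampleComplexity_le (learnable_zero hk hε1 hδ)).trans (by simp)
    · have hk1 : (1 : ℝ) ≤ k := by exact_mod_cast hk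
      have hl : 0 ≤ Real.log (1 / δ) := Real.log_nonneg (by rwa [le_div_iff₀ hδ, one_mul])
      have hx : 1 ≤ ((k : ℝ) + Real.log (1 / δ)) / ε ^ 2 := by
        rw [le_div_iff₀ (by positivity)]
        have : ε ^ 2 ≤ 1 := pow_le_one₀ hε.le hε1.le
        linarith
      set x := ((k : ℝ) + Real.log (1 / δ)) / ε ^ 2
      obtain ⟨hn0, hn⟩ := hemp k ε δ hk hε hδ hδ1 ⌈2 * x⌉₊ (Nat.le_ceil _)
      refine (sampleComplexity_le (learnable_of_empirical hn0 hn)).trans ?_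
      rw [← ENNReal.ofReal_natCast]
      refine ENNReal.ofReal_le_ofReal ?_
      have := Nat.ceil_lt_add_one (show 0 ≤ 2 * x by linarith)
      linarith
  · refine (hemp k ε δ hk hε hδ hδ1 n (le_trans ?_ hn)).2
    have hl : 0 ≤ Real.log (1 / δ) := Real.log_nonneg (by rwa [le_div_iff₀ hδ, one_mul])
    have : 0 ≤ ((k : ℝ) + Real.log (1 / δ)) / ε ^ 2 := by positivity
    linarith
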